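/- Let $m\ge 1$, $n_1,\dots,n_m\ge 1$ and $n=n_1+\dots+n_m$. Consider the interconnected time-varying system $$\dot x_i=f_i(t,x_1,\dots,x_m),\qquad t\ge t_0,\quad x_i\in\mathbb R^{n_i},\quad i=1,\dots,m,$$ written $\dot x=f(t,x)$ with $x=(x_1,\dots,x_m)\in\mathbb R^n$. Assume that $f(t,\cdot)$ is continuously differentiable for each $t\ge t_0$, that $f$ and its Jacobian $\partial_x f$ are piecewise continuous in $t$ (continuous in $(t,x)$ on $[t_0,\infty)\times\mathbb R^n$ away from a locally finite set of times, with limits from the left and from the right, jointly in $(t,x)$, at these times), and that for each $x\in\mathbb R^n$ the solution $\xi(t,t_0,x)$ with $\xi(t_0,t_0,x)=x$ exists for all $t\ge t_0$. Here a solution is continuous and satisfies the equation away from a locally finite set of times. Let $K\subset\mathbb R^n$ be compact with nonempty interior, and let $\xi(t,t_0,K)=\{\xi(t,t_0,x):x\in K\}$ be the reachable set. Let $|\cdot|$ be any norm on $\mathbb R^n$. For $T\ge0$ and $\varepsilon>0$ let $S(f,t_0,\varepsilon,T,K)$ be the minimal cardinality of a set $E\subset K$ such that for every $\bar x\in K$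 there is $x\in E$ with $|\xi(t,t_0,\bar x)-\xi(t,t_0,x)|<\varepsilon$ for all $t\in[t_0,t_0+T]$. The topological entropy is $$h(f,t_0,K)=\lim_{\varepsilon\searrow0}\limsup_{T\to\infty}\frac1T\log S(f,t_0,\varepsilon,T,K).$$ For each $i$ let $|\cdot|_i$ be a norm on $\mathbb R^{n_i}$, with induced norm $\|\cdot\|_i$ on $\mathbb R^{n_i\times n_i}$ and matrix measure $\mu_i(B)=\lim_{s\searrow0}(\|I+sB\|_i-1)/s$. For $B\in\mathbb R^{n_i\times n_j}$ let $\|B\|_{ij}=\max_{|v|_j=1}|Bv|_i$. Define the interconnection matrix function $A_{\mathrm N}(t,x)=[a_{ij}(t,x)]\in\mathbb R^{m\times m}$ by $$a_{ii}(t,x)=\mu_i\bigl(\partial_{x_i}f_i(t,x)\bigr),\qquad a_{ij}(t,x)=\bigl\|\partial_{x_j}f_i(t,x)\bigr\|_{ij}\quad(i\ne j).$$ Suppose that $\hat A_{\mathrm N}=[\hat a_{ij}]\in\mathbb R^{m\times m}$ is a Metzler matrix (its off-diagonal entries are nonnegative) such that $$\hat a_{ij}\ \ge\ \limsup_{t\to\infty}\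 \max_{v\in\operatorname{co}(\xi(t,t_0,K))}a_{ij}(t,v)\qquad\text{for all } i,j\in\{1,\dots,m\},$$ where $\operatorname{co}$ denotes the convex hull. Then $$h(f,t_0,K)\ \le\ n\,\max\{\alpha(\hat A_{\mathrm N}),\,0\},$$ where $\alpha(\hat A_{\mathrm N})$ is the largest real part of the eigenvalues of $\hat A_{\mathrm N}$. -/

import Mathlib

open Set Filter Topology

noncomputable section

section System

variable {V : Type*} [NormedAddCommGroup V] [NormedSpace ℝ V]

/-- `D` has only finitely many points in each bounded interval `[t₀, b]`. -/
def LocallyFiniteAfter (t₀ : ℝ) (D : Set ℝ) : Prop :=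
  ∀ b : ℝ, (D ∩ Icc t₀ b).Finite

/-- A function `F (t, x)` is piecewise continuous in `t` on `[t₀, ∞)` (and continuous in `x`): on the
strips between consecutive points of a locally finite set of times it is continuous in `(t, x)`, and
it has continuous one-sided limits at these times. The values of `F` at the exceptional times are
not restricted here. -/
def PiecewiseContinuousInTime {W : Type*} [TopologicalSpace W] (t₀ : ℝ) (F : ℝ → V → W) : Prop :=
  ∃ D : Set ℝ, LocallyFiniteAfter t₀ D ∧
    (∀ t, t₀ ≤ t → t ∉ D → ∀ x : V,
      ContinuousWithinAt (fun q : ℝ × V => F q.1 q.2) (Ici t₀ ×ˢ univ) (t, x)) ∧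
    (∀ t, t₀ ≤ t → ∀ x : V, ∃ y : W,
      Tendsto (fun q : ℝ × V => F q.1 q.2) (𝓝[>] t ×ˢ 𝓝 x) (𝓝 y)) ∧
    (∀ t, t₀ < t → ∀ x : V, ∃ y : W,
      Tendsto (fun q : ℝ × V => F q.1 q.2) (𝓝[<] t ×ˢ 𝓝 x) (𝓝 y))

/-- `φ` solves `ẋ = f (t, x)` for `t ≥ t₀` with `φ t₀ = x₀`: it is continuous, and the equation holds
away from a locally finite set of times. -/
def IsSolution (f : ℝ → V → V) (t₀ : ℝ) (x₀ : V) (φ : ℝ → V) : Prop :=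
  φ t₀ = x₀ ∧ ContinuousOn φ (Ici t₀) ∧
    ∃ D : Set ℝ, LocallyFiniteAfter t₀ D ∧
      ∀ t, t₀ < t → t ∉ D → HasDerivAt φ (f t (φ t)) t

/-- Standing assumptions on `ẋ = f (t, x)`, `t ≥ t₀`: `f` is piecewise continuous in `t` and
continuously differentiable in `x` (the Jacobian being again piecewise continuous in `t`), and each
initial state has a solution on all of `[t₀, ∞)`. -/
structure IsForwardCompleteSystem (f : ℝ → V → V) (t₀ : ℝ) : Prop where
  piecewiseContinuous : PiecewiseContinuousInTime t₀ f
  contDiff : ∀ t, t₀ ≤ t → ContDiff ℝ 1 (f t)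
  piecewiseContinuous_fderiv : PiecewiseContinuousInTime t₀ (fun t x => fderiv ℝ (f t) x)
  exists_solution : ∀ x : V, ∃ φ : ℝ → V, IsSolution f t₀ x φ

open Classical in
/-- `ξ (t, t₀, x)`: the solution at time `t` with state `x` at time `t₀`. (The value is a default one
if there is no solution on `[t₀, ∞)`.) -/
def flow (f : ℝ → V → V) (t₀ t : ℝ) (x : V) : V :=
  if h : ∃ φ : ℝ → V, IsSolution f t₀ x φ then h.choose t else x

/-- `ξ (t, t₀, K)`. -/
def reachableSet (f : ℝ → V → V) (t₀ : ℝ) (K : Set V) (t : ℝ) : Set V :=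
  flow f t₀ t '' K

/-- The ball `B (x, ε, T)` of states whose trajectories stay `ε`-close, with respect to the norm `p`,
to the one of `x` on `[t₀, t₀ + T]`. -/
def dynBall (p : Seminorm ℝ V) (f : ℝ → V → V) (t₀ : ℝ) (x : V) (ε T : ℝ) : Set V :=
  {y | ∀ t ∈ Icc t₀ (t₀ + T), p (flow f t₀ t y - flow f t₀ t x) < ε}

/-- `E ⊆ K` is `(T, ε)`-spanning for `K`. -/
def IsSpanning (p : Seminorm ℝ V) (f : ℝ → V → V) (t₀ ε T : ℝ) (K E : Set V) : Prop :=
  E ⊆ K ∧ K ⊆ ⋃ x ∈ E, dynBall p f t₀ x ε T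

/-- Minimal cardinality of a `(T, ε)`-spanning set. -/
def spanningNumber (p : Seminorm ℝ V) (f : ℝ → V → V) (t₀ ε T : ℝ) (K : Set V) : ℕ∞ :=
  sInf {k : ℕ∞ | ∃ E : Set V, IsSpanning p f t₀ ε T K E ∧ E.encard = k}

/-- Topological entropy `h (f, t₀, K)`, an extended real number. The limit over `ε ↘ 0` exists in
`[-∞, ∞]`, as the upper limit is nonincreasing in `ε`. -/
def topEntropy (p : Seminorm ℝ V) (f : ℝ → V → V) (t₀ : ℝ) (K : Set V) : EReal :=
  limUnder (𝓝[>] (0 : ℝ)) fun ε : ℝ =>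
    limsup (fun T : ℝ =>
      ((1 / T : ℝ) : EReal) * ENNReal.log ((spanningNumber p f t₀ ε T K : ℕ∞) : ENNReal)) atTop

/-- Matrix measure (logarithmic norm) of `A` with respect to the operator norm. -/
def matrixMeasure (A : V →L[ℝ] V) : ℝ :=
  limUnder (𝓝[>] (0 : ℝ)) fun s : ℝ => (‖ContinuousLinearMap.id ℝ V + s • A‖ - 1) / s

end System

section Interconnection

variable {m : ℕ} {E : Fin m → Type*} [∀ i, NormedAddCommGroup (E i)] [∀ i, NormedSpace ℝ (E i)]

/-- The Jacobian block of `f_i (t, x)` with respect to `x_j`. -/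
def jacobianBlock (f : ℝ → (∀ i, E i) → (∀ i, E i)) (t : ℝ) (x : ∀ i, E i) (i j : Fin m) :
    E j →L[ℝ] E i :=
  (ContinuousLinearMap.proj i).comp
    ((fderiv ℝ (f t) x).comp (ContinuousLinearMap.single ℝ E j))

/-- The interconnection matrix function: local matrix measures on the diagonal, mixed induced norms
off the diagonal. The local norm of the `i`-th subsystem is the norm of `E i`. -/
def interconnectionMatrix (f : ℝ → (∀ i, E i) → (∀ i, E i)) (t : ℝ) (x : ∀ i, E i) :
    Matrix (Fin m) (Fin m) ℝ :=
  Matrix.of fun i j =>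
    if i = j then matrixMeasure (jacobianBlock f t x i i) else ‖jacobianBlock f t x i j‖

/-- A Metzler matrix: nonnegative off-diagonal entries. -/
def IsMetzler (M : Matrix (Fin m) (Fin m) ℝ) : Prop :=
  ∀ i j, i ≠ j → 0 ≤ M i j

/-- Largest real part of the complex eigenvalues of a real matrix. -/
def spectralAbscissa (M : Matrix (Fin m) (Fin m) ℝ) : ℝ :=
  sSup (Complex.re '' spectrum ℂ (M.map Complex.ofReal))

end Interconnection

end

open scoped NNReal

/-!
Let `c` exceed both `α(A)` and `0`. As `A` is Metzler, there is a vector `u` with positive entries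
and `A u < c u`. In the maximum norm of the components weighted by `1 / u i`, a row sum bounds the
matrix measure of the Jacobian, so on the convex hull of the reachable set this measure is
eventually below `c`. By the mean value theorem along segments and an estimate of the Dini
derivative of the weighted distance, trajectories starting in `K` separate at most like `e ^ (c t)`.
A volume count covers the bounded set `K ⊆ ℝⁿ` by `O(e ^ (n c T))` balls of radius proportional to
`ε e ^ (-c T)`, hence the entropy is at most `n c`; finally let `c ↘ max (α(A)) 0`.
-/

section Metzler

open scoped Matrix

variable {m : ℕ} {A : Matrix (Fin m) (Fin m) ℝ} {c s : ℝ}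

lemma isUnit_smul_one_sub_of_spectralAbscissa_lt (hs : spectralAbscissa A < s) :
    IsUnit (s • (1 : Matrix (Fin m) (Fin m) ℝ) - A) := by
  rw [← Algebra.algebraMap_eq_smul_one, ← spectrum.notMem_iff]
  intro hsA
  refine hs.not_ge (le_csSup ((Matrix.finite_spectrum _).image _).bddAbove ⟨(s : ℂ), ?_, by simp⟩)
  rw [Matrix.mem_spectrum_iff_isRoot_charpoly] at hsA ⊢
  have hroot : ((A.map Complex.ofRealHom).charpoly).IsRoot (Complex.ofRealHom s) := by
    rw [Matrix.charpoly_map]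
    exact hsA.map
  exact hroot

lemma mul_sub_mulVec_inv_mulVec_one (hs : spectralAbscissa A < s) (i : Fin m) :
    s * ((s • 1 - A)⁻¹ *ᵥ 1) i - (A *ᵥ ((s • 1 - A)⁻¹ *ᵥ 1)) i = 1 := by
  have hdet := (Matrix.isUnit_iff_isUnit_det _).1 (isUnit_smul_one_sub_of_spectralAbscissa_lt hs)
  have hinv : (s • 1 - A) *ᵥ ((s • 1 - A)⁻¹ *ᵥ 1) = 1 := by
    rw [Matrix.mulVec_mulVec, Matrix.mul_nonsing_inv _ hdet, Matrix.one_mulVec]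
  rw [Matrix.sub_mulVec, Matrix.smul_mulVec, Matrix.one_mulVec] at hinv
  exact congrFun hinv i

lemma continuousOn_inv_mulVec_one (hc : spectralAbscissa A < c) (i : Fin m) :
    ContinuousOn (fun s : ℝ => ((s • 1 - A)⁻¹ *ᵥ 1) i) (Ici c) := by
  intro s hs
  have hunit := isUnit_smul_one_sub_of_spectralAbscissa_lt (hc.trans_le hs)
  have hinv := continuousAt_matrix_inv (s • 1 - A)
    (NormedRing.inverse_continuousAt (hunit.map Matrix.detMonoidHom).unit)
  have hlin : Continuous fun s : ℝ => s • (1 : Matrix (Fin m) (Fin m) ℝ) - A := by fun_prop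
  have hcomp := ContinuousAt.comp (f := fun s : ℝ => s • (1 : Matrix (Fin m) (Fin m) ℝ) - A)
    hinv hlin.continuousAt
  have hmul : Continuous fun M : Matrix (Fin m) (Fin m) ℝ => (M *ᵥ 1) i :=
    (continuous_apply i).comp (continuous_id.matrix_mulVec continuous_const)
  exact (hmul.continuousAt.comp hcomp).continuousWithinAt

lemma IsMetzler.sum_mul_le_mulVec (hA : IsMetzler A) {u : Fin m → ℝ} {i : Fin m}
    (hi : ∀ j, u i ≤ u j) : (∑ j, A i j) * u i ≤ (A *ᵥ u) i := by
  rw [Finset.sum_mul]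
  refine Finset.sum_le_sum fun j _ => ?_
  obtain rfl | hij := eq_or_ne i j
  · exact le_rfl
  · exact mul_le_mul_of_nonneg_left (hi j) (hA i j hij)

lemma IsMetzler.exists_one_le_mul_inf' [Nonempty (Fin m)] (hA : IsMetzler A)
    (hs : spectralAbscissa A < s) :
    ∃ i, 1 ≤ (s - ∑ j, A i j) *
      Finset.univ.inf' Finset.univ_nonempty fun j => ((s • 1 - A)⁻¹ *ᵥ 1) j := by
  obtain ⟨i, -, hi⟩ :=
    Finset.exists_mem_eq_inf' Finset.univ_nonempty fun j => ((s • 1 - A)⁻¹ *ᵥ 1) j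
  have hmin : ∀ j, ((s • 1 - A)⁻¹ *ᵥ 1) i ≤ ((s • 1 - A)⁻¹ *ᵥ 1) j := fun j =>
    hi ▸ Finset.inf'_le _ (Finset.mem_univ j)
  refine ⟨i, hi ▸ ?_⟩
  linarith [mul_sub_mulVec_inv_mulVec_one hs i, hA.sum_mul_le_mulVec hmin]

-- The smallest entry of `(s - A)⁻¹ 1` never vanishes for `s ≥ c` and is positive for large `s`.
lemma IsMetzler.inv_mulVec_one_pos (hA : IsMetzler A) (hc : spectralAbscissa A < c) (i : Fin m) :
    0 < ((c • 1 - A)⁻¹ *ᵥ 1) i := by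
  have : Nonempty (Fin m) := ⟨i⟩
  let μ : ℝ → ℝ := fun s =>
    Finset.univ.inf' Finset.univ_nonempty fun j => ((s • 1 - A)⁻¹ *ᵥ 1) j
  have hμ : ContinuousOn μ (Ici c) :=
    ContinuousOn.finset_inf'_apply _ fun j _ => continuousOn_inv_mulVec_one hc j
  have hμ_ne : ∀ s ∈ Ici c, μ s ≠ 0 := by
    intro s hs h0
    obtain ⟨j, hj⟩ := hA.exists_one_le_mul_inf' (hc.trans_le hs)
    change 1 ≤ _ * μ s at hj
    rw [h0, mul_zero] at hj
    exact one_pos.not_ge hj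
  obtain ⟨s, hcs, hs⟩ : ∃ s, c ≤ s ∧ ∀ j, ∑ k, A j k < s :=
    ((eventually_ge_atTop c).and (eventually_all.2 fun j => eventually_gt_atTop _)).exists
  have hμs : 0 < μ s := by
    obtain ⟨j, hj⟩ := hA.exists_one_le_mul_inf' (hc.trans_le hcs)
    exact pos_of_mul_pos_right (one_pos.trans_le hj) (sub_pos.2 (hs j)).le
  have hμc : 0 < μ c := by
    by_contra! hle
    obtain ⟨r, hr, hr0⟩ := isPreconnected_Ici.intermediate_value self_mem_Ici hcs hμ ⟨hle, hμs.le⟩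
    exact hμ_ne r hr hr0
  exact hμc.trans_le (Finset.inf'_le _ (Finset.mem_univ i))

lemma IsMetzler.exists_pos_mulVec_lt (hA : IsMetzler A) (hc : spectralAbscissa A < c) :
    ∃ u : Fin m → ℝ, (∀ i, 0 < u i) ∧ ∀ i, (A *ᵥ u) i < c * u i :=
  ⟨(c • 1 - A)⁻¹ *ᵥ 1, hA.inv_mulVec_one_pos hc, fun i => by
    linarith [mul_sub_mulVec_inv_mulVec_one hc i]⟩

lemma exists_pos_forall_sum_add_mul_lt {u : Fin m → ℝ} (hu : ∀ i, (A *ᵥ u) i < c * u i) :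
    ∃ δ > 0, ∀ i, ∑ j, (A i j + δ) * u j < c * u i := by
  have hev : ∀ᶠ δ in 𝓝[>] (0 : ℝ), ∀ i, ∑ j, (A i j + δ) * u j < c * u i := by
    rw [eventually_all]
    intro i
    have hcont : Continuous fun δ : ℝ => ∑ j, (A i j + δ) * u j := by fun_prop
    refine nhdsWithin_le_nhds (hcont.tendsto 0 |>.eventually_lt_const ?_)
    simpa [Matrix.mulVec, dotProduct] using hu i
  obtain ⟨δ, hδ, hδ0⟩ := (hev.and self_mem_nhdsWithin).exists
  exact ⟨δ, hδ0, hδ⟩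

end Metzler

lemma eventually_forall_mem_of_forall_eventually_prod {X Y : Type*} [TopologicalSpace X]
    {K : Set X} (hK : IsCompact K) {l : Filter Y} {P : X → Y → Prop}
    (h : ∀ x ∈ K, ∀ᶠ q in 𝓝 x ×ˢ l, P q.1 q.2) : ∀ᶠ y in l, ∀ x ∈ K, P x y := by
  have hprod : ∀ᶠ q in 𝓝ˢ K ×ˢ l, P q.1 q.2 := hK.mem_nhdsSet_prod_of_forall h
  filter_upwards [(Filter.prod_comm (f := 𝓝ˢ K) ▸ hprod).curry] with y hy x hx
  exact hy.self_of_nhdsSet x hx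

section MatrixMeasure

open ContinuousLinearMap

variable {V : Type*} [NormedAddCommGroup V] [NormedSpace ℝ V] [Nontrivial V]

lemma norm_id_add_smul_sub_one_div_monotoneOn (B : V →L[ℝ] V) :
    MonotoneOn (fun s : ℝ => (‖ContinuousLinearMap.id ℝ V + s • B‖ - 1) / s) (Ioi 0) := by
  have hconvex : ConvexOn ℝ univ fun s : ℝ => ‖ContinuousLinearMap.id ℝ V + s • B‖ := by
    have h := convexOn_univ_norm.comp_affineMap (E := ℝ)
      (AffineMap.lineMap (k := ℝ) (ContinuousLinearMap.id ℝ V) (ContinuousLinearMap.id ℝ V + B))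
    simpa [Function.comp_def, AffineMap.lineMap_apply, add_comm] using h
  intro s hs r hr hsr
  simpa using hconvex.secant_mono (mem_univ 0) (mem_univ s) (mem_univ r) (ne_of_gt hs)
    (ne_of_gt hr) hsr

lemma tendsto_matrixMeasure (B : V →L[ℝ] V) :
    Tendsto (fun s : ℝ => (‖ContinuousLinearMap.id ℝ V + s • B‖ - 1) / s) (𝓝[>] 0)
      (𝓝 (matrixMeasure B)) := by
  refine tendsto_nhds_limUnder ⟨_, (norm_id_add_smul_sub_one_div_monotoneOn B).tendsto_nhdsGT
    ⟨-‖B‖, ?_⟩⟩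
  rintro _ ⟨s, hs : 0 < s, rfl⟩
  have h := norm_sub_le (ContinuousLinearMap.id ℝ V + s • B) (s • B)
  rw [add_sub_cancel_right, norm_id, norm_smul, Real.norm_of_nonneg hs.le] at h
  rw [le_div_iff₀ hs]
  linarith

lemma matrixMeasure_le_of_eventually {B : V →L[ℝ] V} {c : ℝ}
    (h : ∀ᶠ s in 𝓝[>] (0 : ℝ), ‖ContinuousLinearMap.id ℝ V + s • B‖ ≤ 1 + s * c) :
    matrixMeasure B ≤ c := by
  refine le_of_tendsto (tendsto_matrixMeasure B) ?_
  filter_upwards [h, self_mem_nhdsWithin] with s hs hs0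
  rw [div_le_iff₀ hs0]
  linarith

lemma eventually_norm_id_add_smul_le {B : V →L[ℝ] V} {c : ℝ} (h : matrixMeasure B < c) :
    ∀ᶠ q in 𝓝 B ×ˢ 𝓝[>] (0 : ℝ), ‖ContinuousLinearMap.id ℝ V + q.2 • q.1‖ ≤ 1 + q.2 * c := by
  obtain ⟨r, hr, hr0⟩ :=
    (((tendsto_matrixMeasure B).eventually_lt_const h).and self_mem_nhdsWithin).exists
  have hcont : Continuous fun B' : V →L[ℝ] V =>
      (‖ContinuousLinearMap.id ℝ V + r • B'‖ - 1) / r := by fun_prop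
  filter_upwards [((hcont.tendsto B).eventually_lt_const hr).prod_mk (Ioc_mem_nhdsGT hr0)]
    with ⟨B', s⟩ ⟨hB', hs⟩
  have hquot := (norm_id_add_smul_sub_one_div_monotoneOn B' hs.1 hr0 hs.2).trans hB'.le
  rw [div_le_iff₀ hs.1] at hquot
  linarith

lemma eventually_norm_sub_add_smul_le {g : V → V} (hg : ContDiff ℝ 1 g) {x y : V} {c : ℝ}
    (hμ : ∀ v ∈ segment ℝ x y, matrixMeasure (fderiv ℝ g v) < c) :
    ∀ᶠ s in 𝓝[>] (0 : ℝ), ‖(y - x) + s • (g y - g x)‖ ≤ (1 + s * c) * ‖y - x‖ := by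
  have hcompact : IsCompact (segment ℝ x y) := by
    rw [segment_eq_image_lineMap]
    exact isCompact_Icc.image AffineMap.lineMap_continuous
  have hstep : ∀ᶠ s in 𝓝[>] (0 : ℝ), ∀ v ∈ segment ℝ x y,
      ‖ContinuousLinearMap.id ℝ V + s • fderiv ℝ g v‖ ≤ 1 + s * c := by
    refine eventually_forall_mem_of_forall_eventually_prod hcompact fun v hv => ?_
    exact (((hg.continuous_fderiv one_ne_zero).tendsto v).prodMap tendsto_id).eventually
      (eventually_norm_id_add_smul_le (hμ v hv))
  filter_upwards [hstep] with s hs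
  have hderiv : ∀ v ∈ segment ℝ x y, HasFDerivWithinAt (fun v => v + s • g v)
      (ContinuousLinearMap.id ℝ V + s • fderiv ℝ g v) (segment ℝ x y) v := fun v _ =>
    ((hasFDerivAt_id v).add
      ((hg.differentiable one_ne_zero v).hasFDerivAt.const_smul s)).hasFDerivWithinAt
  have hmean := (convex_segment x y).norm_image_sub_le_of_norm_hasFDerivWithin_le hderiv hs
    (left_mem_segment ℝ x y) (right_mem_segment ℝ x y)
  convert hmean using 2
  rw [smul_sub]
  abel

end MatrixMeasure

section Block

open ContinuousLinearMap

variable {ι : Type*} [DecidableEq ι] {E : ι → Type*} [∀ i, NormedAddCommGroup (E i)]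
  [∀ i, NormedSpace ℝ (E i)]

/-- The block of an operator on a finite product that maps the `j`-th factor to the `i`-th one; the
Jacobian blocks of a system are the blocks of its derivative. -/
def operatorBlock (J : (∀ i, E i) →L[ℝ] (∀ i, E i)) (i j : ι) : E j →L[ℝ] E i :=
  (proj i).comp (J.comp (single ℝ E j))

/-- Division of each component by a positive weight: the sup norm of the result is the weighted
maximum norm `max i, ‖z i‖ / u i`. -/
noncomputable def rescale (u : ι → ℝ) (hu : ∀ i, 0 < u i) : (∀ i, E i) ≃L[ℝ] (∀ i, E i) :=
  (ContinuousLinearEquiv.piCongrRight fun i =>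
    ContinuousLinearEquiv.smulLeft (Units.mk0 (u i) (hu i).ne')).symm

lemma operatorBlock_conj_rescale {u : ι → ℝ} (hu : ∀ i, 0 < u i)
    (J : (∀ i, E i) →L[ℝ] (∀ i, E i)) (i j : ι) :
    operatorBlock ((rescale u hu).conjContinuousAlgEquiv J) i j
      = ((u i)⁻¹ * u j) • operatorBlock J i j := by
  ext z
  have hsingle : (rescale u hu).symm (Pi.single j z) = u j • (Pi.single j z : ∀ i, E i) := by
    ext k
    obtain rfl | hk := eq_or_ne k j
    · simp [rescale, Units.smul_def]
    · simp [rescale, hk]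
  change (u i)⁻¹ • J ((rescale u hu).symm (Pi.single j z)) i = _
  rw [hsingle, map_smul, Pi.smul_apply, smul_smul]
  rfl

variable [Fintype ι]

lemma apply_eq_sum_operatorBlock (J : (∀ i, E i) →L[ℝ] (∀ i, E i)) (z : ∀ i, E i) (i : ι) :
    J z i = ∑ j, operatorBlock J i j (z j) := by
  conv_lhs => rw [← Finset.univ_sum_single z]
  rw [map_sum, Finset.sum_apply]
  rfl

lemma norm_add_smul_apply_le {J : (∀ i, E i) →L[ℝ] (∀ i, E i)} {B : ι → ι → ℝ} {c s : ℝ} {i : ι}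
    (hs : 0 ≤ s)
    (hdiag : ‖ContinuousLinearMap.id ℝ (E i) + s • operatorBlock J i i‖ ≤ 1 + s * B i i)
    (hoff : ∀ j, i ≠ j → ‖operatorBlock J i j‖ ≤ B i j) (hsum : ∑ j, B i j ≤ c) (z : ∀ i, E i) :
    ‖z i + s • J z i‖ ≤ (1 + s * c) * ‖z‖ := by
  have hdecomp : z i + s • J z i = (ContinuousLinearMap.id ℝ (E i) + s • operatorBlock J i i) (z i)
      + s • ∑ j ∈ Finset.univ.erase i, operatorBlock J i j (z j) := by
    rw [apply_eq_sum_operatorBlock, ← Finset.add_sum_erase _ _ (Finset.mem_univ i), smul_add,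
      ← add_assoc]
    rfl
  have hoff' : ‖∑ j ∈ Finset.univ.erase i, operatorBlock J i j (z j)‖
      ≤ ∑ j ∈ Finset.univ.erase i, B i j * ‖z‖ :=
    norm_sum_le_of_le _ fun j hj =>
      le_of_opNorm_le_of_le _ (hoff j (Finset.ne_of_mem_erase hj).symm) (norm_le_pi_norm z j)
  calc ‖z i + s • J z i‖
      ≤ (1 + s * B i i) * ‖z‖ + s * ∑ j ∈ Finset.univ.erase i, B i j * ‖z‖ := by
        rw [hdecomp]
        refine norm_add_le_of_le (le_of_opNorm_le_of_le _ hdiag (norm_le_pi_norm z i)) ?_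
        rw [norm_smul, Real.norm_of_nonneg hs]
        gcongr
    _ = (1 + s * ∑ j, B i j) * ‖z‖ := by
        rw [← Finset.add_sum_erase _ _ (Finset.mem_univ i), ← Finset.sum_mul]
        ring
    _ ≤ (1 + s * c) * ‖z‖ := by gcongr

variable [Nonempty ι] [∀ i, Nontrivial (E i)]

lemma matrixMeasure_le_of_operatorBlock_le {J : (∀ i, E i) →L[ℝ] (∀ i, E i)} {B : ι → ι → ℝ}
    {c : ℝ} (hdiag : ∀ i, matrixMeasure (operatorBlock J i i) < B i i)
    (hoff : ∀ i j, i ≠ j → ‖operatorBlock J i j‖ ≤ B i j) (hsum : ∀ i, ∑ j, B i j ≤ c) :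
    matrixMeasure J ≤ c := by
  have hstep : ∀ᶠ s in 𝓝[>] (0 : ℝ), ∀ i,
      ‖ContinuousLinearMap.id ℝ (E i) + s • operatorBlock J i i‖ ≤ 1 + s * B i i :=
    eventually_all.2 fun i => (eventually_norm_id_add_smul_le (hdiag i)).curry.self_of_nhds
  have hNontrivial : Nontrivial (∀ i, E i) := Pi.nontrivial_at (Classical.arbitrary ι)
  refine matrixMeasure_le_of_eventually ?_
  filter_upwards [hstep, self_mem_nhdsWithin] with s hs (hs0 : 0 < s)
  have hbound : ∀ z i, ‖z i + s • J z i‖ ≤ (1 + s * c) * ‖z‖ := fun z i =>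
    norm_add_smul_apply_le hs0.le (hs i) (hoff i) (hsum i) z
  have hnonneg : 0 ≤ 1 + s * c := by
    obtain ⟨z, hz⟩ := exists_norm_eq (∀ i, E i) zero_le_one
    simpa [hz] using (norm_nonneg _).trans (hbound z (Classical.arbitrary ι))
  exact opNorm_le_bound _ hnonneg fun z =>
    (pi_norm_le_iff_of_nonneg (by positivity)).2 (hbound z)

lemma matrixMeasure_conj_rescale_le {J : (∀ i, E i) →L[ℝ] (∀ i, E i)} {B : ι → ι → ℝ} {u : ι → ℝ}
    (hu : ∀ i, 0 < u i) {c : ℝ} (hdiag : ∀ i, matrixMeasure (operatorBlock J i i) < B i i)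
    (hoff : ∀ i j, i ≠ j → ‖operatorBlock J i j‖ ≤ B i j)
    (hsum : ∀ i, ∑ j, B i j * u j ≤ c * u i) :
    matrixMeasure ((rescale u hu).conjContinuousAlgEquiv J) ≤ c := by
  refine matrixMeasure_le_of_operatorBlock_le (B := fun i j => (u i)⁻¹ * u j * B i j) ?_ ?_ ?_
  · intro i
    simpa only [operatorBlock_conj_rescale, inv_mul_cancel₀ (hu i).ne', one_smul, one_mul]
      using hdiag i
  · intro i j hij
    have hpos : 0 < (u i)⁻¹ * u j := mul_pos (inv_pos.2 (hu i)) (hu j)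
    rw [operatorBlock_conj_rescale, norm_smul, Real.norm_of_nonneg hpos.le]
    gcongr
    exact hoff i j hij
  · intro i
    calc ∑ j, (u i)⁻¹ * u j * B i j = (u i)⁻¹ * ∑ j, B i j * u j := by
          rw [Finset.mul_sum]
          exact Finset.sum_congr rfl fun j _ => by ring
      _ ≤ c := by
          rw [inv_mul_le_iff₀ (hu i), mul_comm]
          exact hsum i

end Block

section Gronwall

lemma le_mul_exp_of_liminf_deriv_right_le {u : ℝ → ℝ} {c a b : ℝ} (hab : a ≤ b)
    (hu : ContinuousOn u (Icc a b))
    (h : ∀ t ∈ Ioo a b, ∀ r, c * u t < r → ∃ᶠ z in 𝓝[>] t, (z - t)⁻¹ * (u z - u t) < r) :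
    u b ≤ u a * Real.exp (c * (b - a)) := by
  rcases hab.eq_or_lt with rfl | hlt
  · simp
  have hinner : ∀ s ∈ Ioo a b, u b ≤ u s * Real.exp (c * (b - s)) := by
    intro s hs
    have := le_gronwallBound_of_liminf_deriv_right_le (f' := fun t => c * u t) (ε := 0) (K := c)
      (hu.mono (Icc_subset_Icc_left hs.1.le)) (fun t ht => h t ⟨hs.1.trans_le ht.1, ht.2⟩) le_rfl
      (by simp) b (right_mem_Icc.2 hs.2.le)
    rwa [gronwallBound_ε0] at this
  have hlimit : Tendsto (fun s => u s * Real.exp (c * (b - s))) (𝓝[Ioo a b] a)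
      (𝓝 (u a * Real.exp (c * (b - a)))) := by
    have hexp : Continuous fun s => Real.exp (c * (b - s)) := by fun_prop
    exact ((hu a (left_mem_Icc.2 hab)).mono Ioo_subset_Icc_self).mul hexp.continuousWithinAt
  have : (𝓝[Ioo a b] a).NeBot := nhdsWithin_Ioo_eq_nhdsGT hlt ▸ inferInstance
  exact ge_of_tendsto hlimit (eventually_of_mem self_mem_nhdsWithin hinner)

lemma le_mul_exp_of_liminf_deriv_right_le_off_finite {u : ℝ → ℝ} {c : ℝ} {D : Set ℝ}
    (hD : D.Finite) : ∀ {a b : ℝ}, a ≤ b → ContinuousOn u (Icc a b) →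
    (∀ t ∈ Ioo a b, t ∉ D → ∀ r, c * u t < r → ∃ᶠ z in 𝓝[>] t, (z - t)⁻¹ * (u z - u t) < r) →
    u b ≤ u a * Real.exp (c * (b - a)) := by
  induction D, hD using Set.Finite.induction_on with
  | empty =>
    exact fun hab hu h => le_mul_exp_of_liminf_deriv_right_le hab hu fun t ht =>
      h t ht (notMem_empty t)
  | @insert d D _ _ ih =>
    intro a b hab hu h
    by_cases hd : d ∈ Ioo a b
    · have hleft := ih hd.1.le (hu.mono (Icc_subset_Icc_right hd.2.le)) fun t ht htD =>
        h t ⟨ht.1, ht.2.trans hd.2⟩ (by simp [htD, ht.2.ne])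
      have hright := ih hd.2.le (hu.mono (Icc_subset_Icc_left hd.1.le)) fun t ht htD =>
        h t ⟨hd.1.trans ht.1, ht.2⟩ (by simp [htD, ht.1.ne'])
      calc u b ≤ u d * Real.exp (c * (b - d)) := hright
        _ ≤ u a * Real.exp (c * (d - a)) * Real.exp (c * (b - d)) := by gcongr
        _ = u a * Real.exp (c * (b - a)) := by
          rw [mul_assoc, ← Real.exp_add]
          ring_nf
    · refine ih hab hu fun t ht htD => h t ht ?_
      rintro (rfl | h')
      exacts [hd ht, htD h']

variable {V : Type*} [NormedAddCommGroup V] [NormedSpace ℝ V]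

lemma eventually_inv_mul_norm_sub_norm_lt {d : ℝ → V} {d' : V} {c t : ℝ} (hd : HasDerivAt d d' t)
    (heuler : ∀ᶠ s in 𝓝[>] (0 : ℝ), ‖d t + s • d'‖ ≤ (1 + s * c) * ‖d t‖) {r : ℝ}
    (hr : c * ‖d t‖ < r) : ∀ᶠ z in 𝓝[>] t, (z - t)⁻¹ * (‖d z‖ - ‖d t‖) < r := by
  have hshift : Tendsto (fun z => z - t) (𝓝[>] t) (𝓝[>] 0) := by
    refine tendsto_nhdsWithin_iff.2 ⟨?_, eventually_of_mem self_mem_nhdsWithin fun z hz =>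
      mem_Ioi.2 (sub_pos.2 hz)⟩
    exact sub_self t ▸ (tendsto_id.sub_const t).mono_left nhdsWithin_le_nhds
  have hη : 0 < (r - c * ‖d t‖) / 2 := by linarith
  filter_upwards [hshift.eventually heuler,
    nhdsWithin_le_nhds ((hasDerivAt_iff_isLittleO.1 hd).def hη), self_mem_nhdsWithin]
    with z hstep hlittle (hz : t < z)
  have hpos : 0 < z - t := sub_pos.2 hz
  rw [Real.norm_of_nonneg hpos.le] at hlittle
  have htriangle : ‖d z‖ ≤ ‖d t + (z - t) • d'‖ + ‖d z - d t - (z - t) • d'‖ := by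
    have := norm_add_le (d t + (z - t) • d') (d z - d t - (z - t) • d')
    rwa [sub_sub, add_sub_cancel, ← sub_sub] at this
  rw [inv_mul_lt_iff₀ hpos]
  nlinarith

lemma norm_le_mul_exp_of_eventually_norm_add_smul_le {d d' : ℝ → V} {c a b : ℝ} {D : Set ℝ}
    (hD : D.Finite) (hab : a ≤ b) (hd : ContinuousOn d (Icc a b))
    (hderiv : ∀ t ∈ Ioo a b, t ∉ D → HasDerivAt d (d' t) t)
    (heuler : ∀ t ∈ Ioo a b, ∀ᶠ s in 𝓝[>] (0 : ℝ), ‖d t + s • d' t‖ ≤ (1 + s * c) * ‖d t‖) :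
    ‖d b‖ ≤ ‖d a‖ * Real.exp (c * (b - a)) :=
  le_mul_exp_of_liminf_deriv_right_le_off_finite (u := fun t => ‖d t‖) hD hab hd.norm
    fun t ht htD _ hr =>
      (eventually_inv_mul_norm_sub_norm_lt (hderiv t ht htD) (heuler t ht) hr).frequently

end Gronwall

section Solutions

variable {V : Type*} [NormedAddCommGroup V] [NormedSpace ℝ V] {f : ℝ → V → V} {t₀ a b c : ℝ}
  {x y : V} {φ ψ : ℝ → V}

lemma IsSolution.norm_sub_le_mul_exp (hφ : IsSolution f t₀ x φ) (hψ : IsSolution f t₀ y ψ)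
    (ha : t₀ ≤ a) (hab : a ≤ b)
    (heuler : ∀ t ∈ Ioo a b, ∀ᶠ s in 𝓝[>] (0 : ℝ),
      ‖(ψ t - φ t) + s • (f t (ψ t) - f t (φ t))‖ ≤ (1 + s * c) * ‖ψ t - φ t‖) :
    ‖ψ b - φ b‖ ≤ ‖ψ a - φ a‖ * Real.exp (c * (b - a)) := by
  obtain ⟨-, hφc, D, hD, hφ'⟩ := hφ
  obtain ⟨-, hψc, D', hD', hψ'⟩ := hψ
  have hIcc : Icc a b ⊆ Ici t₀ := fun t ht => ha.trans ht.1
  refine norm_le_mul_exp_of_eventually_norm_add_smul_le (d := fun t => ψ t - φ t)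
    ((hD b).union (hD' b)) hab ((hψc.sub hφc).mono hIcc) (fun t ht htD => ?_) heuler
  have ht₀ : t₀ < t := ha.trans_lt ht.1
  have htI : t ∈ Icc t₀ b := ⟨ht₀.le, ht.2.le⟩
  exact (hψ' t ht₀ fun h => htD (Or.inr ⟨h, htI⟩)).sub (hφ' t ht₀ fun h => htD (Or.inl ⟨h, htI⟩))

lemma IsSolution.norm_sub_le_mul_exp_of_lipschitz (hφ : IsSolution f t₀ x φ)
    (hψ : IsSolution f t₀ y ψ) (ha : t₀ ≤ a) (hab : a ≤ b)
    (hlip : ∀ t ∈ Ioo a b, ‖f t (ψ t) - f t (φ t)‖ ≤ c * ‖ψ t - φ t‖) :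
    ‖ψ b - φ b‖ ≤ ‖ψ a - φ a‖ * Real.exp (c * (b - a)) := by
  refine hφ.norm_sub_le_mul_exp hψ ha hab fun t ht => ?_
  filter_upwards [self_mem_nhdsWithin] with s (hs : 0 < s)
  calc ‖(ψ t - φ t) + s • (f t (ψ t) - f t (φ t))‖
      ≤ ‖ψ t - φ t‖ + s * (c * ‖ψ t - φ t‖) := by
        refine norm_add_le_of_le le_rfl ?_
        rw [norm_smul, Real.norm_of_nonneg hs.le]
        gcongr
        exact hlip t ht
    _ = (1 + s * c) * ‖ψ t - φ t‖ := by ring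

lemma IsSolution.norm_sub_le_mul_exp_of_matrixMeasure_lt [Nontrivial V] (hφ : IsSolution f t₀ x φ)
    (hψ : IsSolution f t₀ y ψ) (ha : t₀ ≤ a) (hab : a ≤ b)
    (hf : ∀ t ∈ Ioo a b, ContDiff ℝ 1 (f t))
    (hμ : ∀ t ∈ Ioo a b, ∀ v ∈ segment ℝ (φ t) (ψ t), matrixMeasure (fderiv ℝ (f t) v) < c) :
    ‖ψ b - φ b‖ ≤ ‖ψ a - φ a‖ * Real.exp (c * (b - a)) :=
  hφ.norm_sub_le_mul_exp hψ ha hab fun t ht => eventually_norm_sub_add_smul_le (hf t ht) (hμ t ht)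

variable {W : Type*} [NormedAddCommGroup W] [NormedSpace ℝ W]

lemma IsSolution.conj (R : V ≃L[ℝ] W) (hφ : IsSolution f t₀ x φ) :
    IsSolution (fun t w => R (f t (R.symm w))) t₀ (R x) fun t => R (φ t) := by
  obtain ⟨h₀, hc, D, hD, h'⟩ := hφ
  refine ⟨congrArg R h₀, R.continuous.comp_continuousOn hc, D, hD, fun t ht htD => ?_⟩
  simp only [R.symm_apply_apply]
  exact R.hasFDerivAt.comp_hasDerivAt t (h' t ht htD)

lemma fderiv_conj (R : V ≃L[ℝ] W) (g : V → V) (w : W) :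
    fderiv ℝ (fun w => R (g (R.symm w))) w
      = R.conjContinuousAlgEquiv (fderiv ℝ g (R.symm w)) := by
  change fderiv ℝ (R ∘ (g ∘ R.symm)) w = _
  rw [R.comp_fderiv, R.symm.comp_right_fderiv]
  rfl

lemma IsSolution.norm_map_sub_le_mul_exp [Nontrivial W] (R : V ≃L[ℝ] W)
    (hφ : IsSolution f t₀ x φ) (hψ : IsSolution f t₀ y ψ) (ha : t₀ ≤ a) (hab : a ≤ b)
    (hf : ∀ t ∈ Ioo a b, ContDiff ℝ 1 (f t))
    (hμ : ∀ t ∈ Ioo a b, ∀ v ∈ segment ℝ (φ t) (ψ t),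
      matrixMeasure (R.conjContinuousAlgEquiv (fderiv ℝ (f t) v)) < c) :
    ‖R (ψ b - φ b)‖ ≤ ‖R (ψ a - φ a)‖ * Real.exp (c * (b - a)) := by
  simp only [map_sub]
  refine (hφ.conj R).norm_sub_le_mul_exp_of_matrixMeasure_lt (hψ.conj R) ha hab
    (fun t ht => R.contDiff.comp ((hf t ht).comp R.symm.contDiff)) fun t ht w hw => ?_
  rw [fderiv_conj]
  refine hμ t ht _ ?_
  have hmem : R.symm w ∈ segment ℝ (R.symm (R (φ t))) (R.symm (R (ψ t))) :=
    (image_segment ℝ R.symm.toLinearMap.toAffineMap (R (φ t)) (R (ψ t))).subset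
      (mem_image_of_mem _ hw)
  simpa only [R.symm_apply_apply] using hmem

lemma IsSolution.norm_sub_le_norm_symm_mul_norm_mul_exp [Nontrivial W] (R : V ≃L[ℝ] W)
    (hφ : IsSolution f t₀ x φ) (hψ : IsSolution f t₀ y ψ) (ha : t₀ ≤ a) (hab : a ≤ b)
    (hf : ∀ t ∈ Ioo a b, ContDiff ℝ 1 (f t))
    (hμ : ∀ t ∈ Ioo a b, ∀ v ∈ segment ℝ (φ t) (ψ t),
      matrixMeasure (R.conjContinuousAlgEquiv (fderiv ℝ (f t) v)) < c) :
    ‖ψ b - φ b‖ ≤ ‖(R.symm : W →L[ℝ] V)‖ * ‖(R : V →L[ℝ] W)‖ * Real.exp (c * (b - a))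
      * ‖ψ a - φ a‖ := by
  calc ‖ψ b - φ b‖ ≤ ‖(R.symm : W →L[ℝ] V)‖ * ‖R (ψ b - φ b)‖ := by
        simpa using (R.symm : W →L[ℝ] V).le_opNorm (R (ψ b - φ b))
    _ ≤ ‖(R.symm : W →L[ℝ] V)‖ * (‖R (ψ a - φ a)‖ * Real.exp (c * (b - a))) := by
        gcongr
        exact hφ.norm_map_sub_le_mul_exp R hψ ha hab hf hμ
    _ ≤ ‖(R.symm : W →L[ℝ] V)‖ * (‖(R : V →L[ℝ] W)‖ * ‖ψ a - φ a‖
          * Real.exp (c * (b - a))) := by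
        gcongr
        exact (R : V →L[ℝ] W).le_opNorm _
    _ = _ := by ring

end Solutions

section FiniteTime

variable {V : Type*} [NormedAddCommGroup V] {t₀ : ℝ}

lemma PiecewiseContinuousInTime.isBoundedUnder_norm {W : Type*} [SeminormedAddCommGroup W]
    {F : ℝ → V → W} (hF : PiecewiseContinuousInTime t₀ F) {t : ℝ} (ht : t₀ ≤ t)
    (hFt : Continuous (F t)) (x : V) :
    (𝓝[Ici t₀] t ×ˢ 𝓝 x).IsBoundedUnder (· ≤ ·) fun q : ℝ × V => ‖F q.1 q.2‖ := by
  obtain ⟨D, -, -, hright, hleft⟩ := hF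
  have hbefore : (𝓝[Ico t₀ t] t ×ˢ 𝓝 x).IsBoundedUnder (· ≤ ·) fun q : ℝ × V => ‖F q.1 q.2‖ := by
    rcases ht.eq_or_lt with rfl | hlt
    · rw [Ico_self, nhdsWithin_empty, bot_prod, IsBoundedUnder, Filter.map_bot]
      exact isBounded_bot.2 ⟨0⟩
    · obtain ⟨y, hy⟩ := hleft t hlt x
      exact hy.norm.isBoundedUnder_le.mono
        (prod_mono_left _ (nhdsWithin_mono _ Ico_subset_Iio_self))
  have hat : (pure t ×ˢ 𝓝 x).IsBoundedUnder (· ≤ ·) fun q : ℝ × V => ‖F q.1 q.2‖ := by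
    have hcont : Tendsto (fun q : ℝ × V => F q.1 q.2) (pure t ×ˢ 𝓝 x) (𝓝 (F t x)) := by
      rw [pure_prod, tendsto_map'_iff]
      exact hFt.tendsto x
    exact hcont.norm.isBoundedUnder_le
  have hafter : (𝓝[>] t ×ˢ 𝓝 x).IsBoundedUnder (· ≤ ·) fun q : ℝ × V => ‖F q.1 q.2‖ := by
    obtain ⟨y, hy⟩ := hright t ht x
    exact hy.norm.isBoundedUnder_le
  have hsplit : 𝓝[Ici t₀] t ≤ 𝓝[Ico t₀ t] t ⊔ (pure t ⊔ 𝓝[>] t) := by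
    rw [← nhdsWithin_singleton, ← nhdsWithin_union, ← nhdsWithin_union]
    refine nhdsWithin_mono t fun s hs => ?_
    rcases lt_trichotomy s t with hst | rfl | hst
    exacts [Or.inl ⟨hs, hst⟩, Or.inr (Or.inl rfl), Or.inr (Or.inr hst)]
  refine IsBoundedUnder.mono (prod_mono_left _ hsplit) ?_
  rw [sup_prod, sup_prod, IsBoundedUnder, Filter.map_sup, Filter.map_sup]
  exact isBounded_sup hbefore (isBounded_sup hat hafter)

lemma PiecewiseContinuousInTime.exists_norm_le {W : Type*} [SeminormedAddCommGroup W]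
    {F : ℝ → V → W} (hF : PiecewiseContinuousInTime t₀ F) (hFc : ∀ t, t₀ ≤ t → Continuous (F t))
    {K : Set V} (hK : IsCompact K) (b : ℝ) :
    ∃ L, 0 ≤ L ∧ ∀ t ∈ Icc t₀ b, ∀ x ∈ K, ‖F t x‖ ≤ L := by
  have hlocal : ∀ q ∈ Icc t₀ b ×ˢ K, ∀ᶠ z in 𝓝 q ×ˢ (atTop : Filter ℝ),
      t₀ ≤ z.1.1 → ‖F z.1.1 z.1.2‖ ≤ z.2 := by
    rintro ⟨t, x⟩ ⟨ht, -⟩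
    obtain ⟨M, hM⟩ := (hF.isBoundedUnder_norm ht.1 (hFc t ht.1) x).eventually_le
    rw [← nhdsWithin_univ, ← nhdsWithin_prod_eq, eventually_nhdsWithin_iff] at hM
    filter_upwards [hM.prod_mk (eventually_ge_atTop M)] with z ⟨hz, hMz⟩ htz
    exact (hz ⟨htz, mem_univ _⟩).trans hMz
  obtain ⟨L, hL, hL0⟩ := ((eventually_forall_mem_of_forall_eventually_prod (isCompact_Icc.prod hK)
    (P := fun q M => t₀ ≤ q.1 → ‖F q.1 q.2‖ ≤ M) hlocal).and (eventually_ge_atTop 0)).exists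
  exact ⟨L, hL0, fun t ht x hx => hL (t, x) ⟨ht, hx⟩ ht.1⟩

lemma forall_mem_Icc_lt_of_forall_Ico_lt {u : ℝ → ℝ} {a b r : ℝ} (hu : ContinuousOn u (Icc a b))
    (h : ∀ t ∈ Icc a b, (∀ s ∈ Ico a t, u s < r) → u t < r) : ∀ t ∈ Icc a b, u t < r := by
  by_contra! hexit
  have hcompact : IsCompact (Icc a b ∩ u ⁻¹' Ici r) :=
    isCompact_Icc.of_isClosed_subset (hu.preimage_isClosed_of_isClosed isClosed_Icc isClosed_Ici)
      inter_subset_left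
  obtain ⟨τ, ⟨hτ, hτr⟩, hmin⟩ := hcompact.exists_isLeast hexit
  refine (h τ hτ fun s hs => ?_).not_ge hτr
  by_contra! hsr
  exact hs.2.not_ge (hmin ⟨⟨hs.1, hs.2.le.trans hτ.2⟩, hsr⟩)

namespace IsForwardCompleteSystem

variable [NormedSpace ℝ V] {f : ℝ → V → V} (hf : IsForwardCompleteSystem f t₀)
include hf

lemma isSolution_flow (x : V) : IsSolution f t₀ x fun t => flow f t₀ t x := by
  have h := hf.exists_solution x
  simp only [flow, dif_pos h]
  exact h.choose_spec

lemma flow_self (x : V) : flow f t₀ t₀ x = x :=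
  (hf.isSolution_flow x).1

lemma continuousOn_flow (x : V) : ContinuousOn (fun t => flow f t₀ t x) (Ici t₀) :=
  (hf.isSolution_flow x).2.1

lemma norm_flow_sub_le_mul_exp {b r L : ℝ} (hb : t₀ ≤ b)
    (hL : ∀ t ∈ Icc t₀ b, ∀ x ∈ Metric.closedBall (0 : V) r, ‖fderiv ℝ (f t) x‖ ≤ L) {x y : V}
    (hx : ∀ t ∈ Ico t₀ b, ‖flow f t₀ t x‖ ≤ r) (hy : ∀ t ∈ Ico t₀ b, ‖flow f t₀ t y‖ ≤ r) :
    ‖flow f t₀ b y - flow f t₀ b x‖ ≤ ‖y - x‖ * Real.exp (L * (b - t₀)) := by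
  have hlip : ∀ t ∈ Ioo t₀ b, ‖f t (flow f t₀ t y) - f t (flow f t₀ t x)‖
      ≤ L * ‖flow f t₀ t y - flow f t₀ t x‖ := fun t ht =>
    (convex_closedBall (0 : V) r).norm_image_sub_le_of_norm_fderiv_le
      (fun z _ => (hf.contDiff t ht.1.le).differentiable one_ne_zero z)
      (hL t (Ioo_subset_Icc_self ht)) (by simpa using hx t (Ioo_subset_Ico_self ht))
      (by simpa using hy t (Ioo_subset_Ico_self ht))
  simpa only [hf.flow_self] using
    (hf.isSolution_flow x).norm_sub_le_mul_exp_of_lipschitz (hf.isSolution_flow y) le_rfl hb hlip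

variable [ProperSpace V]

lemma exists_norm_fderiv_le (b r : ℝ) :
    ∃ L, 0 ≤ L ∧ ∀ t ∈ Icc t₀ b, ∀ x ∈ Metric.closedBall (0 : V) r, ‖fderiv ℝ (f t) x‖ ≤ L :=
  hf.piecewiseContinuous_fderiv.exists_norm_le
    (fun t ht => (hf.contDiff t ht).continuous_fderiv one_ne_zero) (isCompact_closedBall 0 r) b

lemma eventually_norm_flow_sub_lt (x : V) (b : ℝ) {r : ℝ} (hr : 0 < r) :
    ∀ᶠ y in 𝓝 x, ∀ t ∈ Icc t₀ b, ‖flow f t₀ t y - flow f t₀ t x‖ < r := by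
  obtain ⟨M, hM⟩ := isCompact_Icc.exists_bound_of_continuousOn
    ((hf.continuousOn_flow x).mono (Icc_subset_Ici_self : Icc t₀ b ⊆ Ici t₀))
  obtain ⟨L, hL0, hL⟩ := hf.exists_norm_fderiv_le b (M + r)
  have hclose : ∀ᶠ y in 𝓝 x, ‖y - x‖ * Real.exp (L * (b - t₀)) < r := by
    have hcont : Continuous fun y : V => ‖y - x‖ * Real.exp (L * (b - t₀)) := by fun_prop
    exact (hcont.tendsto x).eventually_lt_const (by simpa)
  filter_upwards [hclose] with y hy
  refine forall_mem_Icc_lt_of_forall_Ico_lt (((hf.continuousOn_flow y).sub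
    (hf.continuousOn_flow x)).norm.mono Icc_subset_Ici_self) fun t ht hbefore => ?_
  have hIcc : ∀ s ∈ Ico t₀ t, s ∈ Icc t₀ b := fun s hs => ⟨hs.1, hs.2.le.trans ht.2⟩
  have hflow_x : ∀ s ∈ Ico t₀ t, ‖flow f t₀ s x‖ ≤ M + r := fun s hs =>
    (hM s (hIcc s hs)).trans (le_add_of_nonneg_right hr.le)
  have hflow_y : ∀ s ∈ Ico t₀ t, ‖flow f t₀ s y‖ ≤ M + r := fun s hs =>
    (norm_le_norm_add_norm_sub' _ _).trans (add_le_add (hM s (hIcc s hs)) (hbefore s hs).le)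
  calc ‖flow f t₀ t y - flow f t₀ t x‖ ≤ ‖y - x‖ * Real.exp (L * (t - t₀)) :=
        hf.norm_flow_sub_le_mul_exp ht.1 (fun s hs => hL s ⟨hs.1, hs.2.trans ht.2⟩) hflow_x hflow_y
    _ ≤ ‖y - x‖ * Real.exp (L * (b - t₀)) := by
        gcongr
        exact ht.2
    _ < r := hy

lemma exists_norm_flow_le {K : Set V} (hK : Bornology.IsBounded K) (b : ℝ) :
    ∃ M, ∀ x ∈ K, ∀ t ∈ Icc t₀ b, ‖flow f t₀ t x‖ ≤ M := by
  have hlocal : ∀ x ∈ closure K, ∀ᶠ q in 𝓝 x ×ˢ (atTop : Filter ℝ),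
      ∀ t ∈ Icc t₀ b, ‖flow f t₀ t q.1‖ ≤ q.2 := by
    intro x _
    obtain ⟨M, hM⟩ := isCompact_Icc.exists_bound_of_continuousOn
      ((hf.continuousOn_flow x).mono (Icc_subset_Ici_self : Icc t₀ b ⊆ Ici t₀))
    filter_upwards [(hf.eventually_norm_flow_sub_lt x b one_pos).prod_mk
      (eventually_ge_atTop (M + 1))] with q ⟨hq, hMq⟩ t ht
    exact (norm_le_norm_add_norm_sub' _ _).trans
      ((add_le_add (hM t ht) (hq t ht).le).trans hMq)
  obtain ⟨M, hM⟩ := (eventually_forall_mem_of_forall_eventually_prod hK.isCompact_closure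
    (P := fun x M => ∀ t ∈ Icc t₀ b, ‖flow f t₀ t x‖ ≤ M) hlocal).exists
  exact ⟨M, fun x hx => hM x (subset_closure hx)⟩

lemma exists_norm_flow_sub_le {K : Set V} (hK : Bornology.IsBounded K) (b : ℝ) :
    ∃ C, 0 < C ∧ ∀ x ∈ K, ∀ y ∈ K, ∀ t ∈ Icc t₀ b,
      ‖flow f t₀ t y - flow f t₀ t x‖ ≤ C * ‖y - x‖ := by
  obtain ⟨M, hM⟩ := hf.exists_norm_flow_le hK b
  obtain ⟨L, hL0, hL⟩ := hf.exists_norm_fderiv_le b M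
  refine ⟨Real.exp (L * (b - t₀)), Real.exp_pos _, fun x hx y hy t ht => ?_⟩
  have hIcc : ∀ s ∈ Ico t₀ t, s ∈ Icc t₀ b := fun s hs => ⟨hs.1, hs.2.le.trans ht.2⟩
  calc ‖flow f t₀ t y - flow f t₀ t x‖ ≤ ‖y - x‖ * Real.exp (L * (t - t₀)) :=
        hf.norm_flow_sub_le_mul_exp ht.1 (fun s hs => hL s ⟨hs.1, hs.2.trans ht.2⟩)
          (fun s hs => hM x hx s (hIcc s hs)) fun s hs => hM y hy s (hIcc s hs)
    _ ≤ Real.exp (L * (b - t₀)) * ‖y - x‖ := by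
        rw [mul_comm]
        gcongr
        exact ht.2

variable {W : Type*} [NormedAddCommGroup W] [NormedSpace ℝ W] [Nontrivial W]

-- The rate `c` is only available after some time `t₁`; the flow up to `t₁` costs a constant factor.
lemma exists_norm_flow_sub_le_mul_exp {K : Set V} (hK : Bornology.IsBounded K) (R : V ≃L[ℝ] W)
    {c : ℝ} (hc : 0 ≤ c)
    (hμ : ∀ᶠ t in atTop, ∀ v ∈ convexHull ℝ (reachableSet f t₀ K t),
      matrixMeasure (R.conjContinuousAlgEquiv (fderiv ℝ (f t) v)) < c) :
    ∃ C, 0 < C ∧ ∀ x ∈ K, ∀ y ∈ K, ∀ t, t₀ ≤ t →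
      ‖flow f t₀ t y - flow f t₀ t x‖ ≤ C * Real.exp (c * (t - t₀)) * ‖y - x‖ := by
  obtain ⟨t₁, hμ, ht₁⟩ := (eventually_forall_ge_atTop.2 hμ |>.and (eventually_ge_atTop t₀)).exists
  obtain ⟨C, hC, hlip⟩ := hf.exists_norm_flow_sub_le hK t₁
  set κ : ℝ := ‖(R.symm : W →L[ℝ] V)‖ * ‖(R : V →L[ℝ] W)‖
  refine ⟨(1 + κ) * C, by positivity, fun x hx y hy t ht => ?_⟩
  rcases le_total t t₁ with htt₁ | htt₁
  · have hexp : 1 ≤ Real.exp (c * (t - t₀)) :=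
      Real.one_le_exp (mul_nonneg hc (sub_nonneg.2 ht))
    calc ‖flow f t₀ t y - flow f t₀ t x‖ ≤ 1 * C * 1 * ‖y - x‖ := by
          simpa using hlip x hx y hy t ⟨ht, htt₁⟩
      _ ≤ (1 + κ) * C * Real.exp (c * (t - t₀)) * ‖y - x‖ := by
          gcongr
          exact le_add_of_nonneg_right (by positivity)
  · have hsegment : ∀ s ∈ Ioo t₁ t, ∀ v ∈ segment ℝ (flow f t₀ s x) (flow f t₀ s y),
        matrixMeasure (R.conjContinuousAlgEquiv (fderiv ℝ (f s) v)) < c := fun s hs v hv =>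
      hμ s hs.1.le v (segment_subset_convexHull (mem_image_of_mem _ hx) (mem_image_of_mem _ hy) hv)
    calc ‖flow f t₀ t y - flow f t₀ t x‖
        ≤ κ * Real.exp (c * (t - t₁)) * ‖flow f t₀ t₁ y - flow f t₀ t₁ x‖ :=
          (hf.isSolution_flow x).norm_sub_le_norm_symm_mul_norm_mul_exp R (hf.isSolution_flow y)
            ht₁ htt₁ (fun s hs => hf.contDiff s (ht₁.trans hs.1.le)) hsegment
      _ ≤ (1 + κ) * Real.exp (c * (t - t₀)) * (C * ‖y - x‖) := by
          gcongr
          · exact le_add_of_nonneg_left zero_le_one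
          · exact hlip x hx y hy t₁ (right_mem_Icc.2 ht₁)
      _ = _ := by ring

end IsForwardCompleteSystem

end FiniteTime

section Covering

variable {V : Type*} [NormedAddCommGroup V] [NormedSpace ℝ V] [FiniteDimensional ℝ V]

lemma card_le_pow_finrank_of_isSeparated {S : Finset V} {R r : ℝ≥0} (hr : 0 < r)
    (hS : (S : Set V) ⊆ Metric.closedBall 0 R) (hsep : Metric.IsSeparated r (S : Set V)) :
    (S.card : ℝ) ≤ (1 + 2 * R / r) ^ Module.finrank ℝ V := by
  borelize V
  set n := Module.finrank ℝ V
  set μ : MeasureTheory.Measure V := MeasureTheory.Measure.addHaar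
  have hr' : (0 : ℝ) < r := hr
  have hdisjoint : (S : Set V).PairwiseDisjoint fun x => Metric.ball x (r / 2 : ℝ) := by
    intro x hx y hy hxy
    refine Metric.ball_disjoint_ball ?_
    rw [add_halves, ← coe_nndist, NNReal.coe_le_coe, ← ENNReal.coe_le_coe, ← edist_nndist]
    exact (hsep hx hy hxy).le
  have hsubset : ⋃ x ∈ S, Metric.ball x (r / 2 : ℝ) ⊆ Metric.ball (0 : V) (R + r / 2) :=
    iUnion₂_subset fun x hx => Metric.ball_subset_ball' <| by
      linarith [Metric.mem_closedBall.1 (hS hx)]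
  have hball : ∀ (x : V) {ρ : ℝ}, 0 < ρ →
      μ.real (Metric.ball x ρ) = ρ ^ n * μ.real (Metric.ball 0 1) := fun x ρ hρ => by
    rw [MeasureTheory.measureReal_def, μ.addHaar_ball_of_pos x hρ, ENNReal.toReal_mul,
      ENNReal.toReal_ofReal (by positivity), MeasureTheory.measureReal_def]
  have hunit : 0 < μ.real (Metric.ball (0 : V) 1) :=
    ENNReal.toReal_pos (Metric.measure_ball_pos μ 0 one_pos).ne'
      MeasureTheory.measure_ball_lt_top.ne
  have hvolume : S.card * (r / 2 : ℝ) ^ n * μ.real (Metric.ball 0 1)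
      ≤ (R + r / 2 : ℝ) ^ n * μ.real (Metric.ball 0 1) := by
    calc S.card * (r / 2 : ℝ) ^ n * μ.real (Metric.ball 0 1)
        = μ.real (⋃ x ∈ S, Metric.ball x (r / 2 : ℝ)) := by
          rw [MeasureTheory.measureReal_biUnion_finset hdisjoint fun _ _ => measurableSet_ball]
          simp only [hball _ (half_pos hr'), Finset.sum_const, nsmul_eq_mul, mul_assoc]
      _ ≤ μ.real (Metric.ball (0 : V) (R + r / 2)) :=
          MeasureTheory.measureReal_mono hsubset MeasureTheory.measure_ball_lt_top.ne
      _ = _ := hball 0 (by positivity)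
  calc (S.card : ℝ) ≤ (R + r / 2 : ℝ) ^ n / (r / 2 : ℝ) ^ n :=
        (le_div_iff₀ (by positivity)).2 (le_of_mul_le_mul_right hvolume hunit)
    _ = (1 + 2 * R / r) ^ n := by
        rw [← div_pow]
        congr 1
        field_simp
        ring

lemma coveringNumber_le_floor_pow_finrank {K : Set V} {R r : ℝ≥0} (hr : 0 < r)
    (hK : K ⊆ Metric.closedBall 0 R) :
    Metric.coveringNumber r K ≤ ⌊(1 + 2 * R / r : ℝ) ^ Module.finrank ℝ V⌋₊ := by
  refine (Metric.coveringNumber_le_packingNumber r K).trans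
    (iSup₂_le fun S hSK => iSup_le fun hsep => ?_)
  by_contra! hlt
  obtain ⟨S', hS'S, hS'⟩ := exists_subset_encard_eq (Order.add_one_le_of_lt hlt)
  obtain ⟨F, rfl⟩ := (finite_of_encard_eq_coe (k := _ + 1) hS').exists_finset_coe
  have hcard := card_le_pow_finrank_of_isSeparated hr (hS'S.trans (hSK.trans hK)) (hsep.subset hS'S)
  rw [encard_coe_eq_coe_finsetCard] at hS'
  norm_cast at hS'
  exact (Nat.le_floor hcard).not_gt (hS' ▸ Nat.lt_succ_self _)

lemma exists_seminorm_le_mul_norm (p : Seminorm ℝ V) : ∃ P, 0 < P ∧ ∀ z, p z ≤ P * ‖z‖ :=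
  p.bound_of_continuous_normedSpace p.convexOn.locallyLipschitz.continuous

end Covering

section Entropy

lemma limsup_one_div_mul_log_le {S : ℝ → ENNReal} {M a : ℝ} (hM : 0 < M)
    (hS : ∀ᶠ T in atTop, S T ≤ ENNReal.ofReal (M * Real.exp (a * T))) :
    limsup (fun T : ℝ => ((1 / T : ℝ) : EReal) * ENNReal.log (S T)) atTop ≤ a := by
  have hlim : Tendsto (fun T : ℝ => ((T⁻¹ * Real.log M + a : ℝ) : EReal)) atTop (𝓝 a) := by
    refine (continuous_coe_real_ereal.tendsto a).comp ?_
    simpa using (tendsto_inv_atTop_zero.mul_const (Real.log M)).add_const a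
  rw [← hlim.limsup_eq]
  refine limsup_le_limsup ?_
  filter_upwards [hS, eventually_gt_atTop 0] with T hST hT
  calc ((1 / T : ℝ) : EReal) * ENNReal.log (S T)
      ≤ ((1 / T : ℝ) : EReal) * ENNReal.log (ENNReal.ofReal (M * Real.exp (a * T))) :=
        mul_le_mul_of_nonneg_left (ENNReal.log_monotone hST) (EReal.coe_nonneg.2 (by positivity))
    _ = ((1 / T * (Real.log M + a * T) : ℝ) : EReal) := by
        rw [ENNReal.log_ofReal_of_pos (by positivity), Real.log_mul hM.ne' (Real.exp_ne_zero _),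
          Real.log_exp, EReal.coe_mul]
    _ = ((T⁻¹ * Real.log M + a : ℝ) : EReal) := by
        congr 1
        field_simp

variable {V : Type*} [NormedAddCommGroup V] [NormedSpace ℝ V] {p : Seminorm ℝ V} {f : ℝ → V → V}
  {t₀ : ℝ} {K : Set V}

lemma spanningNumber_antitone (T : ℝ) : Antitone fun ε => spanningNumber p f t₀ ε T K := by
  refine fun ε ε' hε => sInf_le_sInf ?_
  rintro _ ⟨S, ⟨hSK, hS⟩, rfl⟩
  exact ⟨S, ⟨hSK, hS.trans (iUnion₂_mono fun x _ y hy t ht => (hy t ht).trans_le hε)⟩, rfl⟩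

lemma tendsto_topEntropy :
    Tendsto (fun ε : ℝ => limsup (fun T : ℝ => ((1 / T : ℝ) : EReal) *
      ENNReal.log ((spanningNumber p f t₀ ε T K : ℕ∞) : ENNReal)) atTop) (𝓝[>] 0)
      (𝓝 (topEntropy p f t₀ K)) := by
  refine tendsto_nhds_limUnder ⟨_, Antitone.tendsto_nhdsGT (fun ε ε' hε => ?_) 0⟩
  refine limsup_le_limsup ?_
  filter_upwards [eventually_gt_atTop (0 : ℝ)] with T hT
  refine mul_le_mul_of_nonneg_left ?_ (EReal.coe_nonneg.2 (by positivity))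
  exact ENNReal.log_monotone (ENat.toENNReal_le.2 (spanningNumber_antitone T hε))

lemma spanningNumber_le_coveringNumber {ε T L : ℝ} {r : ℝ≥0} (hL : 0 ≤ L)
    (hflow : ∀ x ∈ K, ∀ y ∈ K, ∀ t ∈ Icc t₀ (t₀ + T),
      p (flow f t₀ t y - flow f t₀ t x) ≤ L * ‖y - x‖) (hr : L * r < ε) :
    spanningNumber p f t₀ ε T K ≤ Metric.coveringNumber r K := by
  refine le_iInf₂ fun S hSK => le_iInf fun hS => sInf_le ⟨S, ⟨hSK, fun y hy => ?_⟩, rfl⟩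
  obtain ⟨x, hxS, hxy⟩ := mem_iUnion₂.1 (Metric.isCover_iff_subset_iUnion_closedBall.1 hS hy)
  refine mem_iUnion₂.2 ⟨x, hxS, fun t ht => ?_⟩
  calc p (flow f t₀ t y - flow f t₀ t x) ≤ L * ‖y - x‖ := hflow x (hSK hxS) y hy t ht
    _ ≤ L * r := by
        gcongr
        exact mem_closedBall_iff_norm.1 hxy
    _ < ε := hr

variable [FiniteDimensional ℝ V]

lemma spanningNumber_le_ofReal_pow_finrank {R : ℝ≥0} (hK : K ⊆ Metric.closedBall 0 R) {L ε T : ℝ}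
    (hL : 0 < L) (hε : 0 < ε)
    (hflow : ∀ x ∈ K, ∀ y ∈ K, ∀ t ∈ Icc t₀ (t₀ + T),
      p (flow f t₀ t y - flow f t₀ t x) ≤ L * ‖y - x‖) :
    ((spanningNumber p f t₀ ε T K : ℕ∞) : ENNReal)
      ≤ ENNReal.ofReal ((1 + 4 * R * L / ε) ^ Module.finrank ℝ V) := by
  obtain ⟨r, hr⟩ : ∃ r : ℝ≥0, (r : ℝ) = ε / (2 * L) := ⟨⟨_, by positivity⟩, rfl⟩
  have hr0 : (0 : ℝ) < r := hr ▸ by positivity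
  have hLr : L * r < ε := by
    calc L * r = ε / 2 := by
          rw [hr]
          field_simp
      _ < ε := half_lt_self hε
  calc ((spanningNumber p f t₀ ε T K : ℕ∞) : ENNReal)
      ≤ (⌊(1 + 2 * R / r : ℝ) ^ Module.finrank ℝ V⌋₊ : ENNReal) := by
        exact_mod_cast ENat.toENNReal_le.2 ((spanningNumber_le_coveringNumber hL.le hflow hLr).trans
          (coveringNumber_le_floor_pow_finrank hr0 hK))
    _ ≤ ENNReal.ofReal ((1 + 2 * R / r : ℝ) ^ Module.finrank ℝ V) := by
        rw [← ENNReal.ofReal_natCast]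
        exact ENNReal.ofReal_le_ofReal (Nat.floor_le (by positivity))
    _ = ENNReal.ofReal ((1 + 4 * R * L / ε) ^ Module.finrank ℝ V) := by
        rw [hr]
        congr 3
        field_simp
        ring

lemma exists_spanningNumber_le_mul_exp (hK : Bornology.IsBounded K) {c L ε : ℝ} (hc : 0 ≤ c)
    (hL : 0 < L) (hε : 0 < ε)
    (hflow : ∀ x ∈ K, ∀ y ∈ K, ∀ t, t₀ ≤ t →
      p (flow f t₀ t y - flow f t₀ t x) ≤ L * Real.exp (c * (t - t₀)) * ‖y - x‖) :
    ∃ M, 0 < M ∧ ∀ T, 0 ≤ T → ((spanningNumber p f t₀ ε T K : ℕ∞) : ENNReal)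
      ≤ ENNReal.ofReal (M * Real.exp (Module.finrank ℝ V * c * T)) := by
  obtain ⟨R, hR, hKR⟩ := hK.subset_closedBall_lt 0 0
  lift R to ℝ≥0 using hR.le
  refine ⟨(1 + 4 * R * L / ε) ^ Module.finrank ℝ V, by positivity, fun T hT => ?_⟩
  have hflow_T : ∀ x ∈ K, ∀ y ∈ K, ∀ t ∈ Icc t₀ (t₀ + T),
      p (flow f t₀ t y - flow f t₀ t x) ≤ L * Real.exp (c * T) * ‖y - x‖ :=
    fun x hx y hy t ht => (hflow x hx y hy t ht.1).trans <| by
      gcongr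
      linarith [ht.2]
  have hbase : 1 + 4 * R * (L * Real.exp (c * T)) / ε
      ≤ (1 + 4 * R * L / ε) * Real.exp (c * T) := by
    calc 1 + 4 * R * (L * Real.exp (c * T)) / ε
        ≤ Real.exp (c * T) + 4 * R * (L * Real.exp (c * T)) / ε := by
          gcongr
          exact Real.one_le_exp (by positivity)
      _ = (1 + 4 * R * L / ε) * Real.exp (c * T) := by ring
  calc ((spanningNumber p f t₀ ε T K : ℕ∞) : ENNReal)
      ≤ ENNReal.ofReal ((1 + 4 * R * (L * Real.exp (c * T)) / ε) ^ Module.finrank ℝ V) :=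
        spanningNumber_le_ofReal_pow_finrank hKR (by positivity) hε hflow_T
    _ ≤ ENNReal.ofReal (((1 + 4 * R * L / ε) * Real.exp (c * T)) ^ Module.finrank ℝ V) := by
        gcongr
    _ = _ := by rw [mul_pow, ← Real.exp_nat_mul, mul_assoc (Module.finrank ℝ V : ℝ)]

lemma topEntropy_le_finrank_mul (hK : Bornology.IsBounded K) {c C : ℝ} (hc : 0 ≤ c) (hC : 0 < C)
    (hflow : ∀ x ∈ K, ∀ y ∈ K, ∀ t, t₀ ≤ t →
      ‖flow f t₀ t y - flow f t₀ t x‖ ≤ C * Real.exp (c * (t - t₀)) * ‖y - x‖) :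
    topEntropy p f t₀ K ≤ ((Module.finrank ℝ V * c : ℝ) : EReal) := by
  obtain ⟨P, hP, hp⟩ := exists_seminorm_le_mul_norm p
  have hflow_p : ∀ x ∈ K, ∀ y ∈ K, ∀ t, t₀ ≤ t →
      p (flow f t₀ t y - flow f t₀ t x) ≤ P * C * Real.exp (c * (t - t₀)) * ‖y - x‖ :=
    fun x hx y hy t ht => calc
      p (flow f t₀ t y - flow f t₀ t x) ≤ P * ‖flow f t₀ t y - flow f t₀ t x‖ := hp _
      _ ≤ P * (C * Real.exp (c * (t - t₀)) * ‖y - x‖) := by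
          gcongr
          exact hflow x hx y hy t ht
      _ = _ := by ring
  refine le_of_tendsto tendsto_topEntropy ?_
  filter_upwards [self_mem_nhdsWithin] with ε hε
  obtain ⟨M, hM, hspan⟩ := exists_spanningNumber_le_mul_exp hK hc (mul_pos hP hC) hε hflow_p
  exact limsup_one_div_mul_log_le hM ((eventually_ge_atTop 0).mono hspan)

end Entropy

section Interconnection

variable {m : ℕ} {E : Fin m → Type*} [∀ i, NormedAddCommGroup (E i)] [∀ i, NormedSpace ℝ (E i)]
  {f : ℝ → (∀ i, E i) → (∀ i, E i)} {t₀ : ℝ} {K : Set (∀ i, E i)} {A : Matrix (Fin m) (Fin m) ℝ}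

lemma eventually_interconnectionMatrix_lt_add
    (hdom : ∀ i j, limsup (fun t : ℝ =>
        ⨆ v ∈ convexHull ℝ (reachableSet f t₀ K t),
          ((interconnectionMatrix f t v i j : ℝ) : EReal)) atTop ≤ ((A i j : ℝ) : EReal))
    {δ : ℝ} (hδ : 0 < δ) :
    ∀ᶠ t in atTop, ∀ i j, ∀ v ∈ convexHull ℝ (reachableSet f t₀ K t),
      interconnectionMatrix f t v i j < A i j + δ := by
  refine eventually_all.2 fun i => eventually_all.2 fun j => ?_
  have hlt : ((A i j : ℝ) : EReal) < ((A i j + δ : ℝ) : EReal) :=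
    EReal.coe_lt_coe_iff.2 (lt_add_of_pos_right _ hδ)
  filter_upwards [eventually_lt_of_limsup_lt ((hdom i j).trans_lt hlt)] with t ht v hv
  exact EReal.coe_lt_coe_iff.1 ((le_iSup₂ (f := fun v _ =>
    ((interconnectionMatrix f t v i j : ℝ) : EReal)) v hv).trans_lt ht)

variable [∀ i, Nontrivial (E i)]

lemma matrixMeasure_conj_rescale_fderiv_le [Nonempty (Fin m)] {t : ℝ} {v : ∀ i, E i}
    {B : Fin m → Fin m → ℝ} (hB : ∀ i j, interconnectionMatrix f t v i j < B i j) {u : Fin m → ℝ}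
    (hu : ∀ i, 0 < u i) {c : ℝ} (hsum : ∀ i, ∑ j, B i j * u j ≤ c * u i) :
    matrixMeasure ((rescale u hu).conjContinuousAlgEquiv (fderiv ℝ (f t) v)) ≤ c := by
  refine matrixMeasure_conj_rescale_le hu (fun i => ?_) (fun i j hij => ?_) hsum
  · have hdiag := hB i i
    rwa [interconnectionMatrix, Matrix.of_apply, if_pos rfl] at hdiag
  · have hoff := (hB i j).le
    rwa [interconnectionMatrix, Matrix.of_apply, if_neg hij] at hoff

variable [∀ i, FiniteDimensional ℝ (E i)]

lemma topEntropy_le_finrank_mul_of_spectralAbscissa_lt (hm : 1 ≤ m) (p : Seminorm ℝ (∀ i, E i))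
    (hf : IsForwardCompleteSystem f t₀) (hK : Bornology.IsBounded K) (hA : IsMetzler A)
    (hdom : ∀ i j, limsup (fun t : ℝ =>
        ⨆ v ∈ convexHull ℝ (reachableSet f t₀ K t),
          ((interconnectionMatrix f t v i j : ℝ) : EReal)) atTop ≤ ((A i j : ℝ) : EReal))
    {c : ℝ} (hc0 : 0 ≤ c) (hc : spectralAbscissa A < c) :
    topEntropy p f t₀ K ≤ ((Module.finrank ℝ (∀ i, E i) * c : ℝ) : EReal) := by
  have : Nonempty (Fin m) := ⟨⟨0, hm⟩⟩
  have : Nontrivial (∀ i, E i) := Pi.nontrivial_at ⟨0, hm⟩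
  obtain ⟨c', hc', hcc'⟩ := exists_between hc
  obtain ⟨u, hu, hAu⟩ := hA.exists_pos_mulVec_lt hc'
  obtain ⟨δ, hδ, hsum⟩ := exists_pos_forall_sum_add_mul_lt hAu
  have hμ : ∀ᶠ t in atTop, ∀ v ∈ convexHull ℝ (reachableSet f t₀ K t),
      matrixMeasure ((rescale u hu).conjContinuousAlgEquiv (fderiv ℝ (f t) v)) < c := by
    filter_upwards [eventually_interconnectionMatrix_lt_add hdom hδ] with t ht v hv
    exact (matrixMeasure_conj_rescale_fderiv_le (fun i j => ht i j v hv) hu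
      fun i => (hsum i).le).trans_lt hcc'
  obtain ⟨C, hC, hflow⟩ := hf.exists_norm_flow_sub_le_mul_exp hK (rescale u hu) hc0 hμ
  exact topEntropy_le_finrank_mul hK hc0 hC hflow

theorem theorem2_general (hm : 1 ≤ m) (p : Seminorm ℝ (∀ i, E i))
    (hf : IsForwardCompleteSystem f t₀) (hK : Bornology.IsBounded K) (hA : IsMetzler A)
    (hdom : ∀ i j, limsup (fun t : ℝ =>
        ⨆ v ∈ convexHull ℝ (reachableSet f t₀ K t),
          ((interconnectionMatrix f t v i j : ℝ) : EReal)) atTop ≤ ((A i j : ℝ) : EReal)) :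
    topEntropy p f t₀ K ≤
      (((∑ i, Module.finrank ℝ (E i) : ℕ) * max (spectralAbscissa A) 0 : ℝ) : EReal) := by
  rw [← Module.finrank_pi_fintype ℝ]
  have hlim : Tendsto (fun c : ℝ => ((Module.finrank ℝ (∀ i, E i) * c : ℝ) : EReal))
      (𝓝[>] (max (spectralAbscissa A) 0))
      (𝓝 ((Module.finrank ℝ (∀ i, E i) * max (spectralAbscissa A) 0 : ℝ) : EReal)) :=
    ((continuous_coe_real_ereal.comp (continuous_const_mul _)).tendsto _).mono_left
      nhdsWithin_le_nhds
  refine ge_of_tendsto hlim ?_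
  filter_upwards [self_mem_nhdsWithin] with c hc
  exact topEntropy_le_finrank_mul_of_spectralAbscissa_lt hm p hf hK hA hdom
    ((le_max_right _ _).trans hc.le) ((le_max_left _ _).trans_lt hc)

end Interconnection

theorem theorem2 {m : ℕ} (hm : 1 ≤ m) {E : Fin m → Type*}
    [∀ i, NormedAddCommGroup (E i)] [∀ i, NormedSpace ℝ (E i)]
    [∀ i, FiniteDimensional ℝ (E i)] [∀ i, Nontrivial (E i)]
    (p : Seminorm ℝ (∀ i, E i)) (hp : ∀ x, p x = 0 → x = 0)
    (f : ℝ → (∀ i, E i) → (∀ i, E i)) (t₀ : ℝ) (hf : IsForwardCompleteSystem f t₀)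
    (K : Set (∀ i, E i)) (hK : IsCompact K) (hKint : (interior K).Nonempty)
    (A : Matrix (Fin m) (Fin m) ℝ) (hA : IsMetzler A)
    (hdom : ∀ i j, limsup (fun t : ℝ =>
        ⨆ v ∈ convexHull ℝ (reachableSet f t₀ K t),
          ((interconnectionMatrix f t v i j : ℝ) : EReal)) atTop ≤ ((A i j : ℝ) : EReal)) :
    topEntropy p f t₀ K ≤
      (((∑ i, Module.finrank ℝ (E i) : ℕ) * max (spectralAbscissa A) 0 : ℝ) : EReal) :=
  theorem2_general hm p hf hK.isBounded hA hdom
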